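/- A digraph $G=(V,E)$ has a finite vertex set $V$ and a set $E\subseteq V\times V$ of directed edges (loops are allowed, multiple edges are not); write $n=|V|$ and $m=|E|$. It is connected if $V\neq\emptyset$ and any two vertices are joined by a path ignoring directions, Eulerian if the indegree equals the outdegree at every vertex, and regular if for some $d$ all indegrees and outdegrees equal $d$. Assume throughout that $m\geq 1$. The lazy simple random walk on $G$ is the Markov chain on $V$ which at each step stays put with probability $1/2$ and otherwise moves along an outgoing edge chosen uniformly at random (so $P(v,v)=\tfrac12$ if there is no loop at $v$, and $P(v,w)=\frac{1}{2\deg_{\rm out}(v)}\mathbf 1((v,w)\in E)$ for $w\neq v$). With $P$ its transition matrix and $\pi$ its stationary distribution, put for $a>0$ \[ t_{\mathrm{unif}}(a)=\min\Big\{t\in\{0,1,2,\dots\}:\ \max_{x,y}\Big|\frac{P^t(x,y)}{\pi(y)}-1\Big|\leq a\Big\}. \] Theorem. There exist universal constants $c_1,c_2,c_3>0$ such that for every connected Eulerian digraph with $n$ vertices and $m\ge 1$ directed edges, the mixing times of the lazy simple random walk are finite and satisfy \[ t_{\mathrm{unif}}(1/4)\leq c_1\, mn , \qquad t_{\mathrm{unif}}(a)\leq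 \frac{c_2}{a}\,\min\Big(mn,\frac{m^2}{a}\Big)\quad\text{for all } a>0, \] and, if the digraph is moreover regular, \[ t_{\mathrm{unif}}(a)\leq c_3\,\frac{n^2}{a^2}\quad\text{for all } a>0. \] -/

import Mathlib

open scoped Matrix

namespace EulerianMixing

noncomputable section

section Digraph

variable {V : Type*} [Fintype V] (G : Digraph V)

open Classical in
/-- The outdegree of `v`: the number of directed edges `(v, w)`. -/
def outDegree (v : V) : ℕ := (Finset.univ.filter fun w => G.Adj v w).card

open Classical in
/-- The indegree of `v`: the number of directed edges `(w, v)`. -/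
def inDegree (v : V) : ℕ := (Finset.univ.filter fun w => G.Adj w v).card

open Classical in
/-- The number of directed edges (a loop is one edge). -/
def edgeCount : ℕ := (Finset.univ.filter fun e : V × V => G.Adj e.1 e.2).card

/-- Indegree equals outdegree at every vertex. -/
def IsEulerian : Prop := ∀ v, outDegree G v = inDegree G v

/-- All outdegrees and all indegrees are equal to one and the same number. -/
def IsRegular : Prop := ∃ d : ℕ, ∀ v, outDegree G v = d ∧ inDegree G v = d

/-- Any two vertices are joined by a path that ignores the directions of the edges
(and there is at least one vertex). -/
def IsConnected {V : Type*} (G : Digraph V) : Prop := G.toSimpleGraphInclusive.Connected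

open Classical in
/-- The transition matrix of the lazy simple random walk: with probability `1/2` stay put, with
probability `1/2` move along a uniformly chosen outgoing edge. Without a loop at `v` this says
`P(v,v) = 1/2`. It is a stochastic matrix when every outdegree is positive. -/
def lazyWalk : Matrix V V ℝ := Matrix.of fun v w =>
  (if v = w then 1 / 2 else 0) + (if G.Adj v w then 1 / (2 * (outDegree G v : ℝ)) else 0)

end Digraph

section Chain

variable {V : Type*} [Fintype V]

/-- `π` is a probability vector with `π P = π`. -/
def IsStationaryDistribution (P : Matrix V V ℝ) (π : V → ℝ) : Prop :=
  π ∈ stdSimplex ℝ V ∧ π ᵥ* P = π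

/-- The times `t ≥ 0` with `max_{x,y} |P^t(x,y) / π(y) - 1| ≤ ε`. -/
def unifMixedTimes [DecidableEq V] (P : Matrix V V ℝ) (π : V → ℝ) (ε : ℝ) : Set ℕ :=
  {t | ∀ x y, |(P ^ t) x y / π y - 1| ≤ ε}

/-- The `ε`-uniform mixing time: the least element of `unifMixedTimes P π ε`
(meaningful when that set is nonempty). -/
def unifMixingTime [DecidableEq V] (P : Matrix V V ℝ) (π : V → ℝ) (ε : ℝ) : ℕ :=
  sInf (unifMixedTimes P π ε)

end Chain

end

end EulerianMixing

open scoped Matrix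

namespace EulerianMixing

noncomputable section

/-! ### Densities, one-step dissipation, and energy along paths -/

section Energy

variable {V : Type*} (G : Digraph V)

/-! The walk is in general not reversible, but π(v) = deg(v)/m, and laziness still makes χ²-distance
decay. Let f be the density of the walk at some time with respect to π, and u its variance. One step
replaces f(y) by the average of the midpoints (f(x)+f(y))/2 over the in-edges of y, so u falls by at
least energy/(4m) (`sum_sq_densityStep_le`).

The energy is bounded below in terms of u. Since f has mean 1, its maximum is at least 1+u. A
shortest undirected path from the maximum to {f < 1+u/2} meets only {f ≥ 1+u/2} before its end, so
its length L is at most n and, by Markov's inequality, at most 2m/u. Cauchy–Schwarz along it gives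
u² ≤ 8L·energy (`IsDensity.exists_variance_sq_le`), so u² ≲ n·energy and u³ ≲ m·energy. In a
d-regular digraph a geodesic sees any vertex from at most three places, which improves this to d·u³
≲ n·energy (`IsDensity.regular_variance_cube_le`). The resulting recursions give u ≲ mn/t, u ≲ m/√t
and u ≲ n/√t.

Finally P^{2s}(x,y)/π(y) is the π-inner product of the density from x and the density from y of the
walk on the reversed digraph, itself connected and Eulerian; two variance bounds thus give a uniform
one (`add_self_mem_unifMixedTimes`). -/

open Classical in
/-- The indicator of a directed edge. -/
def edgeInd (v w : V) : ℝ := if G.Adj v w then 1 else 0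

/-- The digraph with all edges reversed. -/
def reverse : Digraph V := ⟨fun v w => G.Adj w v⟩

lemma edgeInd_nonneg (v w : V) : 0 ≤ edgeInd G v w := by
  unfold edgeInd; split_ifs <;> norm_num

lemma edgeInd_of_adj {G : Digraph V} {v w : V} (h : G.Adj v w) : edgeInd G v w = 1 := if_pos h

lemma edgeInd_reverse (v w : V) : edgeInd (reverse G) v w = edgeInd G w v := rfl

variable [Fintype V]

/-- The unnormalised Dirichlet form: the sum of squared differences over the directed edges. -/
def energy (f : V → ℝ) : ℝ := ∑ x, ∑ y, edgeInd G x y * (f x - f y) ^ 2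

/-- One step of the lazy walk acting on densities with respect to the degree measure. -/
def densityStep (f : V → ℝ) (y : V) : ℝ :=
  f y / 2 + (∑ x, edgeInd G x y * f x) / (2 * outDegree G y)

/-- The variance of `f` about `1` with respect to the normalised degree measure. -/
def degreeVariance (f : V → ℝ) : ℝ := (∑ y, outDegree G y * (f y - 1) ^ 2) / edgeCount G

lemma sum_edgeInd_out (v : V) : ∑ w, edgeInd G v w = outDegree G v := by
  simp [edgeInd, outDegree]

lemma sum_edgeInd_in (v : V) : ∑ w, edgeInd G w v = inDegree G v := by
  simp [edgeInd, inDegree]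

lemma sum_outDegree : ∑ v, (outDegree G v : ℝ) = edgeCount G := by
  simp_rw [← sum_edgeInd_out]
  rw [← Fintype.sum_prod_type']
  simp [edgeInd, edgeCount]

lemma outDegree_reverse (v : V) : outDegree (reverse G) v = inDegree G v := rfl

variable {G}

lemma IsEulerian.sum_edgeInd_in (hE : IsEulerian G) (v : V) :
    ∑ w, edgeInd G w v = outDegree G v := by
  rw [EulerianMixing.sum_edgeInd_in, hE v]

lemma IsEulerian.reverse (hE : IsEulerian G) : IsEulerian (reverse G) := fun v => (hE v).symm

lemma IsEulerian.edgeCount_reverse (hE : IsEulerian G) :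
    edgeCount (EulerianMixing.reverse G) = edgeCount G := by
  have h : (edgeCount (EulerianMixing.reverse G) : ℝ) = edgeCount G := by
    rw [← sum_outDegree, ← sum_outDegree]
    exact Finset.sum_congr rfl fun v _ => by rw [outDegree_reverse, hE v]
  exact_mod_cast h

lemma IsRegular.reverse (hR : IsRegular G) : IsRegular (reverse G) := by
  obtain ⟨d, hd⟩ := hR
  exact ⟨d, fun v => (hd v).symm⟩

lemma IsConnected.reverse {V : Type*} {G : Digraph V} (hC : IsConnected G) :
    IsConnected (reverse G) := by
  have h : (EulerianMixing.reverse G).toSimpleGraphInclusive = G.toSimpleGraphInclusive := by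
    ext v w
    simp [Digraph.toSimpleGraphInclusive, EulerianMixing.reverse, or_comm]
  rw [IsConnected, h]
  exact hC

lemma outDegree_pos_of_adj {v w : V} (h : G.Adj v w) : 0 < outDegree G v := by
  classical
  exact Finset.card_pos.2 ⟨w, by simpa using h⟩

lemma inDegree_pos_of_adj {v w : V} (h : G.Adj w v) : 0 < inDegree G v :=
  outDegree_pos_of_adj (G := reverse G) h

lemma outDegree_pos (hC : IsConnected G) (hE : IsEulerian G) (hm : 0 < edgeCount G) (v : V) :
    0 < outDegree G v := by
  classical
  by_cases hn : Nontrivial V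
  · obtain ⟨w, hw⟩ := hC.preconnected.exists_adj_of_nontrivial v
    rcases hw.2 with h | h
    · exact outDegree_pos_of_adj h
    · rw [hE v]; exact inDegree_pos_of_adj h
  -- With a single vertex, connectivity supplies no edge; m ≥ 1 supplies a loop.
  · rw [not_nontrivial_iff_subsingleton] at hn
    obtain ⟨e, he⟩ := Finset.card_pos.1 hm
    rw [Subsingleton.elim v e.1]
    exact outDegree_pos_of_adj (by simpa using he)

lemma energy_nonneg (f : V → ℝ) : 0 ≤ energy G f :=
  Finset.sum_nonneg fun x _ => Finset.sum_nonneg fun y _ =>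
    mul_nonneg (edgeInd_nonneg G x y) (sq_nonneg _)

/-- A step of the lazy walk dissipates at least a quarter of the energy. -/
lemma sum_sq_densityStep_le (hE : IsEulerian G) (hd : ∀ v, 0 < outDegree G v) (f : V → ℝ) :
    ∑ y, outDegree G y * densityStep G f y ^ 2 ≤
      ∑ y, outDegree G y * f y ^ 2 - energy G f / 4 := by
  have key : ∀ y, (outDegree G y : ℝ) * densityStep G f y ^ 2 ≤
      ∑ x, edgeInd G x y * ((f x + f y) / 2) ^ 2 := by
    intro y
    have hpos : (0 : ℝ) < outDegree G y := by exact_mod_cast hd y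
    -- The number of in-edges is `outDegree G y`, so the lazy half of the step can be spread evenly
    -- over them.
    have h1 : (outDegree G y : ℝ) * densityStep G f y =
        ∑ x, edgeInd G x y * ((f x + f y) / 2) := by
      have : ∑ x, edgeInd G x y * ((f x + f y) / 2) =
          (∑ x, edgeInd G x y * f x) / 2 + (∑ x, edgeInd G x y) * (f y / 2) := by
        rw [Finset.sum_div, Finset.sum_mul, ← Finset.sum_add_distrib]
        exact Finset.sum_congr rfl fun x _ => by ring
      rw [this, hE.sum_edgeInd_in, densityStep]
      field_simp
      ring
    have h2 : (∑ x, edgeInd G x y * ((f x + f y) / 2)) ^ 2 ≤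
        (∑ x, edgeInd G x y) * ∑ x, edgeInd G x y * ((f x + f y) / 2) ^ 2 :=
      Finset.sum_sq_le_sum_mul_sum_of_sq_le_mul _ (fun x _ => edgeInd_nonneg G x y)
        (fun x _ => mul_nonneg (edgeInd_nonneg G x y) (sq_nonneg _)) (fun x _ => le_of_eq (by ring))
    rw [hE.sum_edgeInd_in, ← h1] at h2
    refine le_of_mul_le_mul_left ?_ hpos
    calc _ = ((outDegree G y : ℝ) * densityStep G f y) ^ 2 := by ring
      _ ≤ _ := h2
  calc _ ≤ ∑ y, ∑ x, edgeInd G x y * ((f x + f y) / 2) ^ 2 := Finset.sum_le_sum fun y _ => key y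
    -- The parallelogram identity ((a+b)/2)² = (a²+b²)/2 - (a-b)²/4 on each edge.
    _ = (∑ y, ∑ x, edgeInd G x y * f x ^ 2) / 2 + (∑ y, ∑ x, edgeInd G x y * f y ^ 2) / 2
        - (∑ y, ∑ x, edgeInd G x y * (f x - f y) ^ 2) / 4 := by
      simp only [Finset.sum_div, ← Finset.sum_add_distrib, ← Finset.sum_sub_distrib]
      exact Finset.sum_congr rfl fun y _ => Finset.sum_congr rfl fun x _ => by ring
    _ = _ := by
      have h1 : ∑ y, ∑ x, edgeInd G x y * f x ^ 2 = ∑ y, outDegree G y * f y ^ 2 := by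
        rw [Finset.sum_comm]
        simp_rw [← Finset.sum_mul, sum_edgeInd_out]
      have h2 : ∑ y, ∑ x, edgeInd G x y * f y ^ 2 = ∑ y, outDegree G y * f y ^ 2 := by
        simp_rw [← Finset.sum_mul, hE.sum_edgeInd_in]
      have h3 : ∑ y, ∑ x, edgeInd G x y * (f x - f y) ^ 2 = energy G f := Finset.sum_comm
      rw [h1, h2, h3]
      ring

/-- A density with respect to the normalised degree measure. -/
structure IsDensity (G : Digraph V) (f : V → ℝ) : Prop where
  nonneg : ∀ v, 0 ≤ f v
  sum_eq : ∑ v, outDegree G v * f v = edgeCount G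

lemma IsDensity.degreeVariance_eq {f : V → ℝ} (hf : IsDensity G f) (hm : 0 < edgeCount G) :
    degreeVariance G f = (∑ y, outDegree G y * f y ^ 2) / edgeCount G - 1 := by
  have hm' : (0 : ℝ) < edgeCount G := by exact_mod_cast hm
  have : ∑ y, (outDegree G y : ℝ) * (f y - 1) ^ 2 =
      ∑ y, outDegree G y * f y ^ 2 - 2 * ∑ v, outDegree G v * f v + ∑ v, (outDegree G v : ℝ) := by
    rw [Finset.mul_sum, ← Finset.sum_sub_distrib, ← Finset.sum_add_distrib]
    exact Finset.sum_congr rfl fun y _ => by ring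
  rw [degreeVariance, this, hf.sum_eq, sum_outDegree]
  field_simp
  ring

lemma degreeVariance_nonneg (f : V → ℝ) : 0 ≤ degreeVariance G f :=
  div_nonneg (Finset.sum_nonneg fun _ _ => by positivity) (Nat.cast_nonneg _)

lemma IsDensity.densityStep (hd : ∀ v, 0 < outDegree G v) {f : V → ℝ}
    (hf : IsDensity G f) : IsDensity G (densityStep G f) where
  nonneg v := add_nonneg (by linarith [hf.nonneg v]) (div_nonneg (Finset.sum_nonneg fun x _ =>
    mul_nonneg (edgeInd_nonneg G x v) (hf.nonneg x)) (by positivity))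
  sum_eq := by
    have h : ∀ v, (outDegree G v : ℝ) * EulerianMixing.densityStep G f v =
        outDegree G v * f v / 2 + (∑ x, edgeInd G x v * f x) / 2 := by
      intro v
      have : (0 : ℝ) < outDegree G v := by exact_mod_cast hd v
      rw [EulerianMixing.densityStep]
      field_simp
    simp_rw [h, Finset.sum_add_distrib, ← Finset.sum_div]
    rw [Finset.sum_comm]
    simp_rw [← Finset.sum_mul, sum_edgeInd_out]
    rw [hf.sum_eq]
    ring

lemma IsDensity.degreeVariance_densityStep_le (hE : IsEulerian G) (hm : 0 < edgeCount G)
    (hd : ∀ v, 0 < outDegree G v) {f : V → ℝ} (hf : IsDensity G f) :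
    degreeVariance G (EulerianMixing.densityStep G f) ≤
      degreeVariance G f - energy G f / (4 * edgeCount G) := by
  have hm' : (0 : ℝ) < edgeCount G := by exact_mod_cast hm
  rw [hf.degreeVariance_eq hm, (hf.densityStep hd).degreeVariance_eq hm]
  have := div_le_div_of_nonneg_right (sum_sq_densityStep_le hE hd f) hm'.le
  rw [sub_div, div_div] at this
  linarith

/-- The maximum of a density exceeds `1` by at least its variance. -/
lemma IsDensity.exists_one_add_variance_le (hm : 0 < edgeCount G) {f : V → ℝ}
    (hf : IsDensity G f) : ∃ p, 1 + degreeVariance G f ≤ f p := by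
  have hm' : (0 : ℝ) < edgeCount G := by exact_mod_cast hm
  by_contra! h
  have hV : Nonempty V := by
    by_contra hV
    rw [not_nonempty_iff] at hV
    simp [edgeCount] at hm
  obtain ⟨p, hp⟩ := Finite.exists_max f
  -- E f² ≤ max f · E f = max f, while E f² = 1 + variance.
  have h1 : ∑ y, (outDegree G y : ℝ) * f y ^ 2 ≤ f p * edgeCount G := by
    rw [← hf.sum_eq, Finset.mul_sum]
    refine Finset.sum_le_sum fun y _ => ?_
    have := mul_le_mul_of_nonneg_left (hp y) (mul_nonneg (Nat.cast_nonneg (outDegree G y))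
      (hf.nonneg y))
    linarith
  have h2 := h p
  rw [hf.degreeVariance_eq hm] at h2
  have := (div_le_iff₀ hm').2 h1
  linarith

lemma IsDensity.exists_le_one (hm : 0 < edgeCount G) {f : V → ℝ}
    (hd : ∀ v, 0 < outDegree G v) (hf : IsDensity G f) : ∃ q, f q ≤ 1 := by
  have hV : Nonempty V := by
    by_contra hV
    rw [not_nonempty_iff] at hV
    simp [edgeCount] at hm
  by_contra! h
  have : ∑ v, (outDegree G v : ℝ) < ∑ v, outDegree G v * f v :=
    Finset.sum_lt_sum_of_nonempty Finset.univ_nonempty fun v _ =>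
      lt_mul_of_one_lt_right (by exact_mod_cast hd v) (h v)
  rw [hf.sum_eq, sum_outDegree] at this
  exact this.false

/-- From `p`, take a shortest path to the sublevel set `{f < s}`. -/
lemma exists_geodesic_to_sublevel {V : Type*} [Finite V] {G : Digraph V} (hC : IsConnected G)
    (f : V → ℝ) (p : V) (s : ℝ) (hs : ∃ q, f q < s) :
    ∃ (L : ℕ) (v : ℕ → V), v 0 = p ∧ f (v L) < s ∧ (∀ i < L, s ≤ f (v i)) ∧
      (∀ i < L, G.toSimpleGraphInclusive.Adj (v i) (v (i + 1))) ∧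
      (∀ i ≤ L, G.toSimpleGraphInclusive.dist p (v i) = i) := by
  -- Since q is a nearest point of the sublevel set, no earlier vertex of a geodesic to q lies in
  -- that set.
  obtain ⟨q, hq, hmin⟩ := Set.exists_min_image {q | f q < s}
    (fun q => G.toSimpleGraphInclusive.dist p q) (Set.toFinite _) hs
  obtain ⟨w, hw⟩ := hC.exists_walk_length_eq_dist p q
  have hdist : ∀ i ≤ w.length, G.toSimpleGraphInclusive.dist p (w.getVert i) = i := by
    intro i hi
    have h := SimpleGraph.length_eq_dist_of_subwalk hw (w.isSubwalk_take i)
    rw [SimpleGraph.Walk.take_length, min_eq_left hi] at h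
    exact h.symm
  refine ⟨w.length, w.getVert, w.getVert_zero, by simpa using hq, fun i hi => ?_,
    fun i hi => w.adj_getVert_succ hi, hdist⟩
  by_contra! hlt
  have := hmin _ hlt
  rw [hdist i hi.le, ← hw] at this
  omega

/-- Cauchy–Schwarz along the path. As the path may use edges backwards, the energy is symmetrised
over ordered pairs, whence the factor 2; distinct v i make the pairs (v i, v (i+1)) distinct. -/
lemma sq_sub_le_of_path (f : V → ℝ) {L : ℕ} {v : ℕ → V}
    (hadj : ∀ i < L, G.toSimpleGraphInclusive.Adj (v i) (v (i + 1)))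
    (hinj : ∀ i < L, ∀ j < L, v i = v j → i = j) :
    (f (v 0) - f (v L)) ^ 2 ≤ L * (2 * energy G f) := by
  classical
  set F : V × V → ℝ := fun e => (edgeInd G e.1 e.2 + edgeInd G e.2 e.1) * (f e.1 - f e.2) ^ 2
  have hF : ∀ e, 0 ≤ F e := fun e =>
    mul_nonneg (add_nonneg (edgeInd_nonneg _ _ _) (edgeInd_nonneg _ _ _)) (sq_nonneg _)
  have htotal : ∑ e, F e = 2 * energy G f := by
    have h1 : ∑ x, ∑ y, edgeInd G y x * (f x - f y) ^ 2 = energy G f := by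
      rw [Finset.sum_comm]
      exact Finset.sum_congr rfl fun x _ => Finset.sum_congr rfl fun y _ => by ring
    rw [two_mul]
    nth_rw 2 [← h1]
    rw [energy, ← Finset.sum_add_distrib, Fintype.sum_prod_type]
    refine Finset.sum_congr rfl fun x _ => ?_
    rw [← Finset.sum_add_distrib]
    exact Finset.sum_congr rfl fun y _ => by simp only [F]; ring
  have hpath : ∑ i ∈ Finset.range L, (f (v (i + 1)) - f (v i)) ^ 2 ≤ 2 * energy G f := by
    calc _ ≤ ∑ i ∈ Finset.range L, F (v i, v (i + 1)) := by
          refine Finset.sum_le_sum fun i hi => ?_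
          have h1 : 1 ≤ edgeInd G (v i) (v (i + 1)) + edgeInd G (v (i + 1)) (v i) := by
            rcases (hadj i (Finset.mem_range.1 hi)).2 with h | h
            · linarith [edgeInd_of_adj h, edgeInd_nonneg G (v (i + 1)) (v i)]
            · linarith [edgeInd_of_adj h, edgeInd_nonneg G (v i) (v (i + 1))]
          have := mul_le_mul_of_nonneg_right h1 (sq_nonneg (f (v i) - f (v (i + 1))))
          simp only [F]
          linarith
      _ = ∑ e ∈ (Finset.range L).image fun i => (v i, v (i + 1)), F e := by
          rw [Finset.sum_image]
          intro i hi j hj h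
          exact hinj i (by simpa using hi) j (by simpa using hj) (Prod.ext_iff.1 h).1
      _ ≤ ∑ e, F e := Finset.sum_le_univ_sum_of_nonneg hF
      _ = _ := htotal
  calc (f (v 0) - f (v L)) ^ 2 = (∑ i ∈ Finset.range L, (f (v (i + 1)) - f (v i))) ^ 2 := by
        rw [Finset.sum_range_sub (fun i => f (v i))]; ring
    _ ≤ L * ∑ i ∈ Finset.range L, (f (v (i + 1)) - f (v i)) ^ 2 := by
        simpa using sq_sum_le_card_mul_sum_sq (s := Finset.range L)
          (f := fun i => f (v (i + 1)) - f (v i))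
    _ ≤ _ := by gcongr

end Energy

/-! ### Lower bounds on the energy in terms of the variance -/

section SuperlevelSets

variable {V : Type*} [Fintype V] {G : Digraph V} {f : V → ℝ}

/-- Markov's inequality, with each vertex weighing at least k. It is used with k = 1, and with k = d
in the regular case. -/
lemma IsDensity.card_superlevel_mul_le (hf : IsDensity G f) {k : ℕ} (hk : ∀ v, k ≤ outDegree G v)
    {s : ℝ} (hs : 0 ≤ s) :
    k * (((Finset.univ.filter fun v => s ≤ f v).card : ℝ) * s) ≤ edgeCount G := by
  rw [← hf.sum_eq]
  calc _ = ∑ v ∈ Finset.univ.filter fun v => s ≤ f v, (k : ℝ) * s := by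
        rw [Finset.sum_const, nsmul_eq_mul]; ring
    _ ≤ ∑ v ∈ Finset.univ.filter fun v => s ≤ f v, outDegree G v * f v := by
        refine Finset.sum_le_sum fun v hv => ?_
        have : (k : ℝ) ≤ outDegree G v := by exact_mod_cast hk v
        exact mul_le_mul this (Finset.mem_filter.1 hv).2 hs (Nat.cast_nonneg _)
    _ ≤ _ := Finset.sum_le_univ_sum_of_nonneg fun v =>
        mul_nonneg (Nat.cast_nonneg _) (hf.nonneg v)

lemma exists_length_energy_bound (hC : IsConnected G) {p : V} {s : ℝ} (hs : ∃ q, f q < s)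
    (hp : s ≤ f p) :
    ∃ L : ℕ, L ≤ (Finset.univ.filter fun v => s ≤ f v).card ∧
      (f p - s) ^ 2 ≤ L * (2 * energy G f) := by
  classical
  obtain ⟨L, v, h0, hL, hlev, hadj, hdist⟩ := exists_geodesic_to_sublevel hC f p s hs
  have hinj : ∀ i < L, ∀ j < L, v i = v j → i = j := fun i hi j hj h => by
    rw [← hdist i hi.le, ← hdist j hj.le, h]
  refine ⟨L, ?_, ?_⟩
  · have : (Finset.range L).card ≤ (Finset.univ.filter fun v => s ≤ f v).card :=
      Finset.card_le_card_of_injOn v (fun i hi => by simpa using hlev i (by simpa using hi))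
        fun i hi j hj h => hinj i (by simpa using hi) j (by simpa using hj) h
    simpa using this
  · refine le_trans ?_ (sq_sub_le_of_path f hadj hinj)
    rw [h0]
    gcongr

/-- The threshold 1 + u/2 lies halfway between the mean and the guaranteed maximum 1 + u: the path
drops by at least u/2, and Markov gives L(1 + u/2) ≤ m. A single L carries both bounds, so either
can be used to eliminate it. -/
lemma IsDensity.exists_variance_sq_le (hC : IsConnected G) (hm : 0 < edgeCount G)
    (hd : ∀ v, 0 < outDegree G v) (hf : IsDensity G f) :
    ∃ L : ℕ, L ≤ Fintype.card V ∧ L * degreeVariance G f ≤ 2 * edgeCount G ∧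
      degreeVariance G f ^ 2 ≤ 8 * L * energy G f := by
  rcases (degreeVariance_nonneg (G := G) f).eq_or_lt with hu | hu
  · exact ⟨0, by simp, by simp, by simp [← hu]⟩
  obtain ⟨p, hp⟩ := hf.exists_one_add_variance_le hm
  obtain ⟨q, hq⟩ := hf.exists_le_one hm hd
  obtain ⟨L, hL, hE⟩ := exists_length_energy_bound (s := 1 + degreeVariance G f / 2) hC
    ⟨q, by linarith⟩ (show _ ≤ f p by linarith)
  have hcard := hf.card_superlevel_mul_le (k := 1) (fun v => hd v)
    (s := 1 + degreeVariance G f / 2) (by linarith)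
  have hL' : (L : ℝ) ≤ (Finset.univ.filter fun v => 1 + degreeVariance G f / 2 ≤ f v).card := by
    exact_mod_cast hL
  refine ⟨L, hL.trans (Finset.card_le_univ _), ?_, ?_⟩
  · have := mul_le_mul_of_nonneg_right hL' (show 0 ≤ 1 + degreeVariance G f / 2 by linarith)
    have h0 : (0 : ℝ) ≤ L := Nat.cast_nonneg L
    push_cast at hcard
    linarith
  · have : (degreeVariance G f / 2) ^ 2 ≤ (f p - (1 + degreeVariance G f / 2)) ^ 2 := by
      gcongr
      linarith
    linarith

lemma IsDensity.variance_sq_le (hC : IsConnected G) (hm : 0 < edgeCount G)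
    (hd : ∀ v, 0 < outDegree G v) (hf : IsDensity G f) :
    degreeVariance G f ^ 2 ≤ 8 * Fintype.card V * energy G f := by
  obtain ⟨L, hL, -, h⟩ := hf.exists_variance_sq_le hC hm hd
  have hL' : (L : ℝ) ≤ Fintype.card V := by exact_mod_cast hL
  have := energy_nonneg (G := G) f
  exact h.trans (by gcongr)

lemma IsDensity.variance_cube_le (hC : IsConnected G) (hm : 0 < edgeCount G)
    (hd : ∀ v, 0 < outDegree G v) (hf : IsDensity G f) :
    degreeVariance G f ^ 3 ≤ 16 * edgeCount G * energy G f := by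
  obtain ⟨L, -, hL, h⟩ := hf.exists_variance_sq_le hC hm hd
  have hu := degreeVariance_nonneg (G := G) f
  have hE := energy_nonneg (G := G) f
  calc degreeVariance G f ^ 3 = degreeVariance G f ^ 2 * degreeVariance G f := by ring
    _ ≤ 8 * L * energy G f * degreeVariance G f := by gcongr
    _ = 8 * (L * degreeVariance G f) * energy G f := by ring
    _ ≤ 8 * (2 * edgeCount G) * energy G f := by gcongr
    _ = _ := by ring

/-- Along a geodesic, a vertex is an out-neighbour of at most three vertices. -/
lemma sum_edgeInd_geodesic_le {V : Type*} {G : Digraph V} (hC : IsConnected G) {L : ℕ} {v : ℕ → V} {p : V}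
    (hdist : ∀ i ≤ L, G.toSimpleGraphInclusive.dist p (v i) = i) (y : V) :
    ∑ i ∈ Finset.range L, edgeInd G (v i) y ≤ 3 := by
  classical
  have hone : ∀ x, G.Adj x y → G.toSimpleGraphInclusive.dist x y ≤ 1 := by
    intro x hx
    by_cases hxy : x = y
    · simp [hxy]
    · exact (SimpleGraph.dist_eq_one_iff_adj.2 (show _ ∧ _ from ⟨hxy, Or.inl hx⟩)).le
  -- Two vertices with the common out-neighbour y are at undirected distance at most 2, so on a
  -- geodesic their indices differ by at most 2.
  have hclose : ∀ i ≤ L, ∀ j ≤ L, G.Adj (v i) y → G.Adj (v j) y → i ≤ j + 2 := by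
    intro i hi j hj hai haj
    have h1 := hC.dist_triangle (u := p) (v := v j) (w := v i)
    have h2 := hC.dist_triangle (u := v j) (v := y) (w := v i)
    rw [hdist i hi, hdist j hj] at h1
    have h3 := hone _ hai
    have h4 := hone _ haj
    rw [SimpleGraph.dist_comm] at h3
    omega
  have hcard : ((Finset.range L).filter fun i => G.Adj (v i) y).card ≤ 3 := by
    rcases ((Finset.range L).filter fun i => G.Adj (v i) y).eq_empty_or_nonempty with h | h
    · simp [h]
    · set a := Finset.min' _ h
      have ha := Finset.mem_filter.1 (Finset.min'_mem _ h)
      refine (Finset.card_le_card (t := Finset.Icc a (a + 2)) fun i hi => ?_).trans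
        (by rw [Nat.card_Icc]; omega)
      have hi' := Finset.mem_filter.1 hi
      exact Finset.mem_Icc.2 ⟨Finset.min'_le _ i hi,
        hclose i (Finset.mem_range.1 hi'.1).le a (Finset.mem_range.1 ha.1).le hi'.2 ha.2⟩
  calc ∑ i ∈ Finset.range L, edgeInd G (v i) y
      = (((Finset.range L).filter fun i => G.Adj (v i) y).card : ℝ) := by simp [edgeInd]
    _ ≤ 3 := by exact_mod_cast hcard

/-- A vertex many of whose out-neighbours lie in a lower sublevel set carries much energy. -/
lemma mul_sub_le_energy {x : V} {s r : ℝ} (hr : 0 ≤ r) (hx : s + r ≤ f x) :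
    r ^ 2 * (outDegree G x - ∑ y ∈ Finset.univ.filter fun y => s ≤ f y, edgeInd G x y) ≤
      energy G f := by
  have h1 : ∑ y, edgeInd G x y * (f x - f y) ^ 2 ≤ energy G f :=
    Finset.single_le_sum (f := fun x => ∑ y, edgeInd G x y * (f x - f y) ^ 2)
      (fun z _ => Finset.sum_nonneg fun y _ => mul_nonneg (edgeInd_nonneg G z y) (sq_nonneg _))
      (Finset.mem_univ x)
  refine le_trans ?_ h1
  rw [← sum_edgeInd_out, Finset.sum_filter, ← Finset.sum_sub_distrib, Finset.mul_sum]
  refine Finset.sum_le_sum fun y _ => ?_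
  have h0 := edgeInd_nonneg G x y
  split_ifs with h
  · simpa using mul_nonneg h0 (sq_nonneg _)
  · rw [sub_zero, mul_comm]
    gcongr
    linarith

/-- Let T = {f ≥ 1 + u/2} and follow a geodesic down to level 1 + 3u/4. If some vertex on it before
the end sends at least half of its edges out of T, each such edge drops by at least u/4 and these
alone carry enough energy. Otherwise each has more than d/2 out-neighbours in T; every point of T is
counted at most three times, so L ≤ 6|T|/d ≤ 12n/(du). -/
lemma IsDensity.regular_variance_cube_le (hC : IsConnected G) (hm : 0 < edgeCount G)
    {d : ℕ} (hd0 : 0 < d) (hd : ∀ v, outDegree G v = d) (hf : IsDensity G f) :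
    d * degreeVariance G f ^ 3 ≤ 384 * Fintype.card V * energy G f := by
  classical
  set u := degreeVariance G f with hu_def
  have hd0' : (0 : ℝ) < d := by exact_mod_cast hd0
  have hE := energy_nonneg (G := G) f
  have hn0 : (0 : ℝ) ≤ Fintype.card V := Nat.cast_nonneg _
  rcases (degreeVariance_nonneg (G := G) f).eq_or_lt with hu | hu
  · rw [hu_def, ← hu]
    simp only [ne_eq, OfNat.ofNat_ne_zero, not_false_eq_true, zero_pow, mul_zero]
    positivity
  rw [← hu_def] at hu
  have hmn : (edgeCount G : ℝ) = d * Fintype.card V := by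
    rw [← sum_outDegree]
    simp [hd, mul_comm]
  obtain ⟨p, hp⟩ := hf.exists_one_add_variance_le hm
  obtain ⟨q, hq⟩ := hf.exists_le_one hm (fun v => by rw [hd v]; exact hd0)
  rw [← hu_def] at hp
  have hcard : ∀ s : ℝ, 0 ≤ s →
      ((Finset.univ.filter fun v => s ≤ f v).card : ℝ) * s ≤ Fintype.card V := by
    intro s hs
    have := hf.card_superlevel_mul_le (k := d) (fun v => (hd v).ge) hs
    rw [hmn] at this
    exact le_of_mul_le_mul_left this hd0'
  -- Markov at the level f p, whose superlevel set contains p, gives 1 + u ≤ f p ≤ n.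
  have hun : u ≤ Fintype.card V := by
    have h1 := hcard (f p) (hf.nonneg p)
    have h2 : (1 : ℝ) ≤ (Finset.univ.filter fun v => f p ≤ f v).card := by
      exact_mod_cast Finset.card_pos.2 ⟨p, by simp⟩
    have := mul_le_mul_of_nonneg_right h2 (hf.nonneg p)
    linarith
  obtain ⟨L, v, h0, hL, hlev, hadj, hdist⟩ :=
    exists_geodesic_to_sublevel hC f p (1 + u / 2 + u / 4) ⟨q, by linarith⟩
  have hinj : ∀ i < L, ∀ j < L, v i = v j → i = j := fun i hi j hj h => by
    rw [← hdist i hi.le, ← hdist j hj.le, h]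
  set T := Finset.univ.filter fun y => 1 + u / 2 ≤ f y with hT
  by_cases hcase : ∃ i < L, ∑ y ∈ T, edgeInd G (v i) y ≤ d / 2
  · obtain ⟨i, hi, hle⟩ := hcase
    have h1 := mul_sub_le_energy (G := G) (by linarith) (hlev i hi)
    rw [hd, ← hT] at h1
    have h2 : (u / 4) ^ 2 * (d / 2) ≤ energy G f := le_trans (by gcongr; linarith) h1
    calc (d : ℝ) * u ^ 3 = 32 * u * ((u / 4) ^ 2 * (d / 2)) := by ring
      _ ≤ 32 * Fintype.card V * energy G f := by gcongr
      _ ≤ _ := by gcongr; norm_num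
  · push Not at hcase
    have h1 : L * ((d : ℝ) / 2) ≤ T.card * 3 := by
      calc L * ((d : ℝ) / 2) = ∑ i ∈ Finset.range L, (d : ℝ) / 2 := by simp
        _ ≤ ∑ i ∈ Finset.range L, ∑ y ∈ T, edgeInd G (v i) y :=
            Finset.sum_le_sum fun i hi => (hcase i (Finset.mem_range.1 hi)).le
        _ = ∑ y ∈ T, ∑ i ∈ Finset.range L, edgeInd G (v i) y := Finset.sum_comm
        _ ≤ ∑ y ∈ T, (3 : ℝ) :=
            Finset.sum_le_sum fun y _ => sum_edgeInd_geodesic_le hC hdist y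
        _ = _ := by simp
    have h2 : (T.card : ℝ) * (u / 2) ≤ Fintype.card V := by
      have := hcard (1 + u / 2) (by linarith)
      have : (0 : ℝ) ≤ T.card := Nat.cast_nonneg _
      linarith
    have h3 := sq_sub_le_of_path f hadj hinj
    rw [h0] at h3
    have h4 : (u / 4) ^ 2 ≤ L * (2 * energy G f) := by
      refine le_trans ?_ h3
      gcongr
      linarith
    calc (d : ℝ) * u ^ 3 = 16 * d * u * (u / 4) ^ 2 := by ring
      _ ≤ 16 * d * u * (L * (2 * energy G f)) := by gcongr
      _ = 64 * (L * ((d : ℝ) / 2)) * u * energy G f := by ring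
      _ ≤ 64 * (T.card * 3) * u * energy G f := by gcongr
      _ = 384 * (T.card * (u / 2)) * energy G f := by ring
      _ ≤ _ := by gcongr

end SuperlevelSets

/-! ### Decay of the recursive inequalities -/

section Recursion

/-- A nonnegative sequence with `w (t + 1) ≤ w t - (w t) ^ 2 / K` is at most `K / t`. -/
lemma mul_le_of_quadratic_decay {w : ℕ → ℝ} {K : ℝ} (hK : 0 < K) (h0 : ∀ t, 0 ≤ w t)
    (h : ∀ t, w (t + 1) ≤ w t - w t ^ 2 / K) (t : ℕ) : t * w t ≤ K := by
  induction t with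
  | zero => simpa using hK.le
  | succ t ih =>
    have h1 := mul_le_mul_of_nonneg_left (h t) (show (0 : ℝ) ≤ t + 1 by positivity)
    have h2 : ((t : ℝ) + 1) * (w t - w t ^ 2 / K) * K ≤ K * K := by
      have h3 : ((t : ℝ) + 1) * (w t - w t ^ 2 / K) * K = ((t : ℝ) + 1) * w t * (K - w t) := by
        field_simp
      -- If w t exceeded K, the next term would be negative.
      have h4 : w t ≤ K := by
        have := (h0 (t + 1)).trans (h t)
        by_contra! hlt
        have h5 : w t < w t ^ 2 / K := by
          rw [lt_div_iff₀ hK]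
          nlinarith [h0 t]
        linarith
      have h6 := mul_le_mul_of_nonneg_right ih (sub_nonneg.2 h4)
      rw [h3]
      nlinarith [sq_nonneg (w t)]
    push_cast
    exact h1.trans (le_of_mul_le_mul_right h2 hK)

/-- A nonnegative sequence with `w (t + 1) ≤ w t - (w t) ^ 3 / K` is at most `√(K / t)`. -/
lemma mul_sq_le_of_cubic_decay {w : ℕ → ℝ} {K : ℝ} (hK : 0 < K) (h0 : ∀ t, 0 ≤ w t)
    (h : ∀ t, w (t + 1) ≤ w t - w t ^ 3 / K) (t : ℕ) : t * w t ^ 2 ≤ K := by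
  -- The squares satisfy the quadratic recursion with the same K.
  refine mul_le_of_quadratic_decay (w := fun t => w t ^ 2) hK (fun t => sq_nonneg _)
    (fun t => ?_) t
  have h1 : w (t + 1) ≤ w t := (h t).trans (sub_le_self _ (div_nonneg (pow_nonneg (h0 t) 3) hK.le))
  calc w (t + 1) ^ 2 = w (t + 1) * w (t + 1) := sq _
    _ ≤ w t * (w t - w t ^ 3 / K) := mul_le_mul h1 (h t) (h0 _) (h0 _)
    _ = _ := by ring

end Recursion

/-! ### The stationary distribution and the walk's densities -/

section Walk

variable {V : Type*} [Fintype V] {G : Digraph V}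

lemma lazyWalk_apply [DecidableEq V] (v w : V) :
    lazyWalk G v w =
      (if v = w then 1 / 2 else 0) + edgeInd G v w / (2 * (outDegree G v : ℝ)) := by
  simp only [lazyWalk, edgeInd, Matrix.of_apply]
  split_ifs <;> simp

lemma degreeVariance_reverse (hE : IsEulerian G) (f : V → ℝ) :
    degreeVariance (reverse G) f = degreeVariance G f := by
  rw [degreeVariance, degreeVariance, hE.edgeCount_reverse]
  simp_rw [outDegree_reverse, ← hE _]

lemma eq_of_energy_nonpos (hC : IsConnected G) {f : V → ℝ} (h : energy G f ≤ 0) (x y : V) :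
    f x = f y := by
  have hadj : ∀ x y, G.Adj x y → f x = f y := by
    intro x y hxy
    have h1 : edgeInd G x y * (f x - f y) ^ 2 ≤ energy G f :=
      (Finset.single_le_sum (f := fun y => edgeInd G x y * (f x - f y) ^ 2)
        (fun y _ => mul_nonneg (edgeInd_nonneg G x y) (sq_nonneg _)) (Finset.mem_univ y)).trans
      (Finset.single_le_sum (f := fun x => ∑ y, edgeInd G x y * (f x - f y) ^ 2)
        (fun z _ => Finset.sum_nonneg fun y _ => mul_nonneg (edgeInd_nonneg G z y) (sq_nonneg _))
        (Finset.mem_univ x))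
    rw [edgeInd_of_adj hxy, one_mul] at h1
    exact sub_eq_zero.1 (pow_eq_zero_iff two_ne_zero |>.1 (le_antisymm (h1.trans h) (sq_nonneg _)))
  obtain ⟨w⟩ := hC.preconnected x y
  induction w with
  | nil => rfl
  | cons hxy _ ih => exact (hxy.2.elim (hadj _ _) fun h => (hadj _ _ h).symm).trans ih

/-- The stationary distribution is proportional to the degree. -/
lemma IsStationaryDistribution.eq_degree (hC : IsConnected G) (hE : IsEulerian G)
    (hm : 0 < edgeCount G) {π : V → ℝ} (hπ : IsStationaryDistribution (lazyWalk G) π) (v : V) :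
    π v = outDegree G v / edgeCount G := by
  classical
  have hd := outDegree_pos hC hE hm
  have hd' : ∀ v, (outDegree G v : ℝ) ≠ 0 := fun v => by exact_mod_cast (hd v).ne'
  have hm' : (edgeCount G : ℝ) ≠ 0 := by exact_mod_cast hm.ne'
  set g : V → ℝ := fun v => π v / outDegree G v with hg
  -- Stationarity makes π/deg a fixed point of the step, so the dissipation inequality forces its
  -- energy to vanish and g is constant.
  have hstep : ∀ y, densityStep G g y = g y := by
    intro y
    have h1 := congrFun hπ.2 y
    simp only [Matrix.vecMul, dotProduct, lazyWalk_apply, mul_add, Finset.sum_add_distrib,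
      mul_ite, mul_zero, Finset.sum_ite_eq', Finset.mem_univ, if_true] at h1
    have h2 : ∑ x, π x * (edgeInd G x y / (2 * (outDegree G x : ℝ))) =
        (∑ x, edgeInd G x y * g x) / 2 := by
      rw [Finset.sum_div]
      refine Finset.sum_congr rfl fun x _ => ?_
      have := hd' x
      simp only [hg]
      field_simp
    rw [h2] at h1
    have h3 : ∑ x, edgeInd G x y * g x = π y := by linarith
    have := hd' y
    rw [densityStep, h3]
    simp only [hg]
    field_simp
    norm_num
  have hen : energy G g ≤ 0 := by
    have := sum_sq_densityStep_le hE hd g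
    simp_rw [hstep] at this
    linarith
  have hconst : ∀ w, π w = outDegree G w * g v := by
    intro w
    rw [← eq_of_energy_nonpos hC hen w v]
    have := hd' w
    simp only [hg]
    field_simp
  have hsum : (edgeCount G : ℝ) * g v = 1 := by
    rw [← sum_outDegree, Finset.sum_mul, ← hπ.1.2]
    exact Finset.sum_congr rfl fun w _ => (hconst w).symm
  rw [hconst v, eq_div_iff hm']
  linear_combination (outDegree G v : ℝ) * hsum

/-- The density of the point mass at `x`. -/
def pointDensity [DecidableEq V] (G : Digraph V) (x y : V) : ℝ :=
  if x = y then (edgeCount G : ℝ) / outDegree G y else 0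

/-- The density at time `t` of the lazy walk started at `x`. -/
def walkDensity [DecidableEq V] (G : Digraph V) (x : V) (t : ℕ) : V → ℝ :=
  (densityStep G)^[t] (pointDensity G x)

lemma walkDensity_succ [DecidableEq V] (x : V) (t : ℕ) :
    walkDensity G x (t + 1) = densityStep G (walkDensity G x t) :=
  Function.iterate_succ_apply' _ _ _

lemma isDensity_walkDensity [DecidableEq V] (hd : ∀ v, 0 < outDegree G v) (x : V) (t : ℕ) :
    IsDensity G (walkDensity G x t) := by
  induction t with
  | zero =>
    refine ⟨fun v => ?_, ?_⟩
    · simp only [walkDensity, Function.iterate_zero, id, pointDensity]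
      split_ifs <;> positivity
    · have : (outDegree G x : ℝ) ≠ 0 := by exact_mod_cast (hd x).ne'
      simp [walkDensity, pointDensity, mul_div_cancel₀, this]
  | succ t ih => rw [walkDensity_succ]; exact ih.densityStep hd

lemma walkDensity_eq [DecidableEq V] (hd : ∀ v, 0 < outDegree G v) (x y : V) (t : ℕ) :
    walkDensity G x t y = edgeCount G * (lazyWalk G ^ t) x y / outDegree G y := by
  have hd' : ∀ v, (outDegree G v : ℝ) ≠ 0 := fun v => by exact_mod_cast (hd v).ne'
  induction t generalizing y with
  | zero =>
    simp only [walkDensity, Function.iterate_zero, id, pointDensity, pow_zero, Matrix.one_apply]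
    split_ifs <;> simp
  | succ t ih =>
    rw [walkDensity_succ, densityStep, pow_succ, Matrix.mul_apply]
    simp_rw [ih, lazyWalk_apply, mul_add, Finset.sum_add_distrib]
    simp only [mul_ite, mul_zero, Finset.sum_ite_eq', Finset.mem_univ, if_true]
    have h : ∑ z, edgeInd G z y * (edgeCount G * (lazyWalk G ^ t) x z / outDegree G z) =
        2 * edgeCount G * ∑ z, (lazyWalk G ^ t) x z * (edgeInd G z y / (2 * outDegree G z)) := by
      rw [Finset.mul_sum]
      refine Finset.sum_congr rfl fun z _ => ?_
      have := hd' z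
      field_simp
    rw [h]
    have := hd' y
    field_simp

/-- The walk on the reversed digraph is the time reversal of the walk: its density from y is z ↦
P^t(z,y)/π(y). -/
lemma walkDensity_reverse_eq [DecidableEq V] (hE : IsEulerian G) (hd : ∀ v, 0 < outDegree G v)
    (y z : V) (t : ℕ) :
    walkDensity (reverse G) y t z = edgeCount G * (lazyWalk G ^ t) z y / outDegree G y := by
  have hd' : ∀ v, (outDegree G v : ℝ) ≠ 0 := fun v => by exact_mod_cast (hd v).ne'
  induction t generalizing z with
  | zero =>
    simp only [walkDensity, Function.iterate_zero, id, pointDensity, pow_zero, Matrix.one_apply,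
      hE.edgeCount_reverse, outDegree_reverse, ← hE _]
    by_cases h : y = z
    · simp [h]
    · simp [h, Ne.symm h]
  | succ t ih =>
    -- The last step of the reversed walk is the first step of the forward one, so the power is
    -- peeled from the left.
    rw [walkDensity_succ, densityStep, pow_succ', Matrix.mul_apply]
    simp_rw [ih, lazyWalk_apply, add_mul, Finset.sum_add_distrib, edgeInd_reverse,
      outDegree_reverse, ← hE _]
    simp only [ite_mul, zero_mul, Finset.sum_ite_eq, Finset.mem_univ, if_true]
    have h : ∑ w, edgeInd G z w * (edgeCount G * (lazyWalk G ^ t) w y / outDegree G y) =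
        2 * edgeCount G * outDegree G z / outDegree G y *
          ∑ w, edgeInd G z w / (2 * outDegree G z) * (lazyWalk G ^ t) w y := by
      rw [Finset.mul_sum]
      refine Finset.sum_congr rfl fun w _ => ?_
      have := hd' z
      have := hd' y
      field_simp
    rw [h]
    have := hd' y
    have := hd' z
    field_simp

/-! ### From variance to uniform mixing -/

lemma IsDensity.abs_sum_mul_sub_one_le (hm : 0 < edgeCount G) {f h : V → ℝ} (hf : IsDensity G f)
    (hh : IsDensity G h) :
    |(∑ z, outDegree G z * (f z * h z)) / edgeCount G - 1| ≤
      (degreeVariance G f + degreeVariance G h) / 2 := by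
  have hm' : (0 : ℝ) < edgeCount G := by exact_mod_cast hm
  -- Both densities have mean 1, so E(fh) - 1 = E((f-1)(h-1)); then 2|ab| ≤ a² + b².
  have hexp : (∑ z, outDegree G z * (f z * h z)) / edgeCount G - 1 =
      (∑ z, outDegree G z * ((f z - 1) * (h z - 1))) / edgeCount G := by
    have : ∑ z, (outDegree G z : ℝ) * ((f z - 1) * (h z - 1)) =
        ∑ z, outDegree G z * (f z * h z) - ∑ z, outDegree G z * f z - ∑ z, outDegree G z * h z
          + ∑ z, (outDegree G z : ℝ) := by
      simp only [← Finset.sum_sub_distrib, ← Finset.sum_add_distrib]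
      exact Finset.sum_congr rfl fun z _ => by ring
    rw [this, hf.sum_eq, hh.sum_eq, sum_outDegree]
    field_simp
    ring
  rw [hexp, abs_div, abs_of_pos hm', degreeVariance, degreeVariance, ← add_div, div_right_comm]
  refine div_le_div_of_nonneg_right ?_ hm'.le
  refine (Finset.abs_sum_le_sum_abs _ _).trans ?_
  rw [← Finset.sum_add_distrib, Finset.sum_div]
  refine Finset.sum_le_sum fun z _ => ?_
  rw [abs_mul, Nat.abs_cast, ← mul_add, mul_div_assoc]
  refine mul_le_mul_of_nonneg_left (abs_le.2 ⟨?_, ?_⟩) (Nat.cast_nonneg _)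
  · linarith [sq_nonneg ((f z - 1) + (h z - 1))]
  · linarith [sq_nonneg ((f z - 1) - (h z - 1))]

lemma add_self_mem_unifMixedTimes [DecidableEq V] (hC : IsConnected G) (hE : IsEulerian G)
    (hm : 0 < edgeCount G) {π : V → ℝ} (hπ : IsStationaryDistribution (lazyWalk G) π)
    {a : ℝ} {s : ℕ} (hs : ∀ x, degreeVariance G (walkDensity G x s) ≤ a)
    (hs' : ∀ x, degreeVariance (reverse G) (walkDensity (reverse G) x s) ≤ a) :
    s + s ∈ unifMixedTimes (lazyWalk G) π a := by
  intro x y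
  have hd := outDegree_pos hC hE hm
  have hd' : ∀ v, (outDegree G v : ℝ) ≠ 0 := fun v => by exact_mod_cast (hd v).ne'
  have hm' : (edgeCount G : ℝ) ≠ 0 := by exact_mod_cast hm.ne'
  have hf := isDensity_walkDensity hd x s
  have hh : IsDensity G (walkDensity (reverse G) y s) := by
    have h := isDensity_walkDensity (G := reverse G)
      (fun v => by rw [outDegree_reverse, ← hE v]; exact hd v) y s
    refine ⟨h.nonneg, ?_⟩
    have h2 := h.sum_eq
    rw [hE.edgeCount_reverse] at h2
    rw [← h2]
    exact Finset.sum_congr rfl fun v _ => by rw [outDegree_reverse, hE v]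
  have hkey := hf.abs_sum_mul_sub_one_le hm hh
  have h1 : (lazyWalk G ^ (s + s)) x y / π y =
      (∑ z, outDegree G z * (walkDensity G x s z * walkDensity (reverse G) y s z)) /
        edgeCount G := by
    rw [hπ.eq_degree hC hE hm, pow_add, Matrix.mul_apply, Finset.sum_div, Finset.sum_div]
    refine Finset.sum_congr rfl fun z _ => ?_
    rw [walkDensity_eq hd, walkDensity_reverse_eq hE hd]
    have := hd' y
    have := hd' z
    field_simp
  rw [h1]
  have h2 := hs' y
  rw [degreeVariance_reverse hE] at h2
  linarith [hs x]

/-- Covers large a, where the claimed bound may be below 1 and rounding a time up to an integer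
would be too costly. -/
lemma zero_mem_unifMixedTimes [DecidableEq V] (hC : IsConnected G) (hE : IsEulerian G)
    (hm : 0 < edgeCount G) {π : V → ℝ} (hπ : IsStationaryDistribution (lazyWalk G) π)
    {a : ℝ} (ha : 1 ≤ a) (h : ∀ v, (edgeCount G : ℝ) / outDegree G v ≤ a) :
    0 ∈ unifMixedTimes (lazyWalk G) π a := by
  intro x y
  rw [hπ.eq_degree hC hE hm, pow_zero, Matrix.one_apply]
  split_ifs
  · rw [one_div_div, abs_le]
    have : (0 : ℝ) ≤ edgeCount G / outDegree G y := by positivity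
    constructor <;> linarith [h y]
  · simpa using ha

lemma walkDensity_variance_succ_le [DecidableEq V] (hE : IsEulerian G) (hm : 0 < edgeCount G)
    (hd : ∀ v, 0 < outDegree G v) (x : V) (t : ℕ) {δ : ℝ}
    (hδ : δ * (4 * edgeCount G) ≤ energy G (walkDensity G x t)) :
    degreeVariance G (walkDensity G x (t + 1)) ≤ degreeVariance G (walkDensity G x t) - δ := by
  have hm' : (0 : ℝ) < edgeCount G := by exact_mod_cast hm
  rw [walkDensity_succ]
  have h1 := (isDensity_walkDensity hd x t).degreeVariance_densityStep_le hE hm hd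
  have h2 := (le_div_iff₀ (by positivity)).2 hδ
  linarith

lemma mul_variance_le [DecidableEq V] (hC : IsConnected G) (hE : IsEulerian G)
    (hm : 0 < edgeCount G) (x : V) (t : ℕ) :
    t * degreeVariance G (walkDensity G x t) ≤ 32 * (edgeCount G * Fintype.card V) := by
  have hm' : (0 : ℝ) < edgeCount G := by exact_mod_cast hm
  have hn' : (0 : ℝ) < Fintype.card V := by exact_mod_cast Fintype.card_pos_iff.2 ⟨x⟩
  have hd := outDegree_pos hC hE hm
  refine mul_le_of_quadratic_decay (w := fun t => degreeVariance G (walkDensity G x t))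
    (by positivity) (fun t => degreeVariance_nonneg _) (fun t => ?_) t
  refine walkDensity_variance_succ_le hE hm hd x t ?_
  -- 32 = 4 · 8: the dissipation energy/(4m) combined with u² ≤ 8n·energy.
  have h := (isDensity_walkDensity hd x t).variance_sq_le hC hm hd
  rw [div_mul_eq_mul_div, div_le_iff₀ (by positivity)]
  calc _ ≤ 8 * Fintype.card V * energy G (walkDensity G x t) * (4 * edgeCount G) := by gcongr
    _ = _ := by ring

lemma mul_variance_sq_le [DecidableEq V] (hC : IsConnected G) (hE : IsEulerian G)
    (hm : 0 < edgeCount G) (x : V) (t : ℕ) :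
    t * degreeVariance G (walkDensity G x t) ^ 2 ≤ 64 * (edgeCount G : ℝ) ^ 2 := by
  have hm' : (0 : ℝ) < edgeCount G := by exact_mod_cast hm
  have hd := outDegree_pos hC hE hm
  refine mul_sq_le_of_cubic_decay (w := fun t => degreeVariance G (walkDensity G x t))
    (by positivity) (fun t => degreeVariance_nonneg _) (fun t => ?_) t
  refine walkDensity_variance_succ_le hE hm hd x t ?_
  have h := (isDensity_walkDensity hd x t).variance_cube_le hC hm hd
  rw [div_mul_eq_mul_div, div_le_iff₀ (by positivity)]
  calc _ ≤ 16 * edgeCount G * energy G (walkDensity G x t) * (4 * edgeCount G) := by gcongr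
    _ = _ := by ring

lemma edgeCount_eq_of_regular {d : ℕ} (hR : ∀ v, outDegree G v = d) :
    (edgeCount G : ℝ) = d * Fintype.card V := by
  rw [← sum_outDegree]
  simp [hR, mul_comm]

lemma mul_variance_sq_le_of_regular [DecidableEq V] (hC : IsConnected G) (hE : IsEulerian G)
    (hm : 0 < edgeCount G) (hR : IsRegular G) (x : V) (t : ℕ) :
    t * degreeVariance G (walkDensity G x t) ^ 2 ≤ 1536 * (Fintype.card V : ℝ) ^ 2 := by
  have hn' : (0 : ℝ) < Fintype.card V := by exact_mod_cast Fintype.card_pos_iff.2 ⟨x⟩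
  have hd := outDegree_pos hC hE hm
  obtain ⟨d, hdR⟩ := hR
  have hd0 : 0 < d := (hdR x).1 ▸ hd x
  have hd0' : (0 : ℝ) < d := by exact_mod_cast hd0
  refine mul_sq_le_of_cubic_decay (w := fun t => degreeVariance G (walkDensity G x t))
    (by positivity) (fun t => degreeVariance_nonneg _) (fun t => ?_) t
  refine walkDensity_variance_succ_le hE hm hd x t ?_
  -- 1536 = 4 · 384; the degree cancels against m = dn.
  have h := (isDensity_walkDensity hd x t).regular_variance_cube_le hC hm hd0 fun v => (hdR v).1
  rw [edgeCount_eq_of_regular fun v => (hdR v).1, div_mul_eq_mul_div, div_le_iff₀ (by positivity)]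
  calc _ = d * degreeVariance G (walkDensity G x t) ^ 3 * (4 * Fintype.card V) := by ring
    _ ≤ 384 * Fintype.card V * energy G (walkDensity G x t) * (4 * Fintype.card V) := by gcongr
    _ = _ := by ring

/-! ### The mixing time bounds -/

/-- If the double of every time past `k * B` is mixed, and either `1 ≤ B` or time `0` is mixed,
then the mixing time is at most `(2 * k + 2) * B`. -/
lemma unifMixingTime_le_of_add_self_mem [DecidableEq V] {P : Matrix V V ℝ} {π : V → ℝ}
    {a k B : ℝ} (hk : 0 ≤ k) (hB : 0 ≤ B)
    (h : ∀ s : ℕ, k * B ≤ s → s + s ∈ unifMixedTimes P π a)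
    (h0 : B < 1 → 0 ∈ unifMixedTimes P π a) :
    (unifMixedTimes P π a).Nonempty ∧ (unifMixingTime P π a : ℝ) ≤ (2 * k + 2) * B := by
  rcases lt_or_ge B 1 with h1 | h1
  · refine ⟨⟨0, h0 h1⟩, ?_⟩
    have : unifMixingTime P π a = 0 := Nat.le_zero.1 (Nat.sInf_le (h0 h1))
    rw [this]
    push_cast
    positivity
  -- Since 1 ≤ B, rounding up costs at most B; doubling gives 2k + 2.
  · have hmem := h ⌈k * B⌉₊ (Nat.le_ceil _)
    refine ⟨⟨_, hmem⟩, ?_⟩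
    have h2 : (unifMixingTime P π a : ℝ) ≤ (⌈k * B⌉₊ + ⌈k * B⌉₊ : ℕ) := by
      exact_mod_cast Nat.sInf_le hmem
    have h3 := Nat.ceil_lt_add_one (mul_nonneg hk hB)
    push_cast at h2
    linarith

lemma le_of_mul_le_of_div_le {s : ℕ} {b c K : ℝ} (hb : 0 < b) (hK : 0 < K) (h : s * c ≤ K)
    (hs : K / b ≤ s) : c ≤ b := by
  have hs0 : (0 : ℝ) < s := (div_pos hK hb).trans_le hs
  exact le_of_mul_le_mul_left (h.trans ((div_le_iff₀ hb).1 hs)) hs0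

lemma edgeCount_div_outDegree_le (hd : ∀ v, 0 < outDegree G v) (v : V) :
    (edgeCount G : ℝ) / outDegree G v ≤ edgeCount G :=
  div_le_self (Nat.cast_nonneg _) (by exact_mod_cast hd v)

lemma unifMixingTime_le_edges_mul_vertices [DecidableEq V] (hC : IsConnected G)
    (hE : IsEulerian G) (hm : 0 < edgeCount G) {π : V → ℝ}
    (hπ : IsStationaryDistribution (lazyWalk G) π) {a : ℝ} (ha : 0 < a) :
    (unifMixedTimes (lazyWalk G) π a).Nonempty ∧
      (unifMixingTime (lazyWalk G) π a : ℝ) ≤ 66 * (edgeCount G * Fintype.card V / a) := by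
  have hV : Nonempty V := hC.nonempty
  have hm1 : (1 : ℝ) ≤ edgeCount G := by exact_mod_cast hm
  have hn1 : (1 : ℝ) ≤ Fintype.card V := by exact_mod_cast Fintype.card_pos
  have h := unifMixingTime_le_of_add_self_mem (P := lazyWalk G) (π := π) (a := a) (k := 32)
    (B := edgeCount G * Fintype.card V / a) (by norm_num) (by positivity) (fun s hs => ?_)
    fun hB => ?_
  · norm_num at h ⊢
    exact h
  · rw [← mul_div_assoc] at hs
    refine add_self_mem_unifMixedTimes hC hE hm hπ (fun x => ?_) fun x => ?_
    · exact le_of_mul_le_of_div_le ha (by positivity) (mul_variance_le hC hE hm x s) hs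
    · have hx := mul_variance_le hC.reverse hE.reverse (by rwa [hE.edgeCount_reverse]) x s
      rw [hE.edgeCount_reverse] at hx
      exact le_of_mul_le_of_div_le ha (by positivity) hx hs
  · rw [div_lt_one ha] at hB
    have : (edgeCount G : ℝ) ≤ edgeCount G * Fintype.card V :=
      le_mul_of_one_le_right (by positivity) hn1
    exact zero_mem_unifMixedTimes hC hE hm hπ (by linarith) fun v =>
      (edgeCount_div_outDegree_le (outDegree_pos hC hE hm) v).trans (by linarith)

lemma unifMixingTime_le_edges_sq [DecidableEq V] (hC : IsConnected G)
    (hE : IsEulerian G) (hm : 0 < edgeCount G) {π : V → ℝ}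
    (hπ : IsStationaryDistribution (lazyWalk G) π) {a : ℝ} (ha : 0 < a) :
    (unifMixedTimes (lazyWalk G) π a).Nonempty ∧
      (unifMixingTime (lazyWalk G) π a : ℝ) ≤ 130 * ((edgeCount G : ℝ) ^ 2 / a ^ 2) := by
  have hm1 : (1 : ℝ) ≤ edgeCount G := by exact_mod_cast hm
  have h := unifMixingTime_le_of_add_self_mem (P := lazyWalk G) (π := π) (a := a) (k := 64)
    (B := (edgeCount G : ℝ) ^ 2 / a ^ 2) (by norm_num) (by positivity) (fun s hs => ?_)
    fun hB => ?_
  · norm_num at h ⊢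
    exact h
  · rw [← mul_div_assoc] at hs
    refine add_self_mem_unifMixedTimes hC hE hm hπ (fun x => ?_) fun x => ?_
    · exact (sq_le_sq₀ (degreeVariance_nonneg _) ha.le).1 (le_of_mul_le_of_div_le (by positivity) (by positivity)
        (mul_variance_sq_le hC hE hm x s) hs)
    · have hx := mul_variance_sq_le hC.reverse hE.reverse (by rwa [hE.edgeCount_reverse]) x s
      rw [hE.edgeCount_reverse] at hx
      exact (sq_le_sq₀ (degreeVariance_nonneg _) ha.le).1 (le_of_mul_le_of_div_le (by positivity) (by positivity) hx hs)
  · rw [div_lt_one (by positivity)] at hB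
    have hma := lt_of_pow_lt_pow_left₀ 2 ha.le hB
    exact zero_mem_unifMixedTimes hC hE hm hπ (by linarith) fun v =>
      (edgeCount_div_outDegree_le (outDegree_pos hC hE hm) v).trans hma.le

lemma unifMixingTime_le_of_regular [DecidableEq V] (hC : IsConnected G)
    (hE : IsEulerian G) (hm : 0 < edgeCount G) (hR : IsRegular G) {π : V → ℝ}
    (hπ : IsStationaryDistribution (lazyWalk G) π) {a : ℝ} (ha : 0 < a) :
    (unifMixedTimes (lazyWalk G) π a).Nonempty ∧
      (unifMixingTime (lazyWalk G) π a : ℝ) ≤ 3074 * ((Fintype.card V : ℝ) ^ 2 / a ^ 2) := by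
  have hV : Nonempty V := hC.nonempty
  have hn1 : (1 : ℝ) ≤ Fintype.card V := by exact_mod_cast Fintype.card_pos
  have h := unifMixingTime_le_of_add_self_mem (P := lazyWalk G) (π := π) (a := a) (k := 1536)
    (B := (Fintype.card V : ℝ) ^ 2 / a ^ 2) (by norm_num) (by positivity) (fun s hs => ?_)
    fun hB => ?_
  · norm_num at h ⊢
    exact h
  · rw [← mul_div_assoc] at hs
    refine add_self_mem_unifMixedTimes hC hE hm hπ (fun x => ?_) fun x => ?_
    · exact (sq_le_sq₀ (degreeVariance_nonneg _) ha.le).1 (le_of_mul_le_of_div_le (by positivity) (by positivity)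
        (mul_variance_sq_le_of_regular hC hE hm hR x s) hs)
    · exact (sq_le_sq₀ (degreeVariance_nonneg _) ha.le).1 (le_of_mul_le_of_div_le (by positivity) (by positivity)
        (mul_variance_sq_le_of_regular hC.reverse hE.reverse (by rwa [hE.edgeCount_reverse])
          hR.reverse x s) hs)
  · rw [div_lt_one (by positivity)] at hB
    have hna := lt_of_pow_lt_pow_left₀ 2 ha.le hB
    refine zero_mem_unifMixedTimes hC hE hm hπ (by linarith) fun v => ?_
    obtain ⟨d, hdR⟩ := hR
    have hd := outDegree_pos hC hE hm v
    rw [(hdR v).1] at hd ⊢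
    have hd' : (d : ℝ) ≠ 0 := by exact_mod_cast hd.ne'
    rw [edgeCount_eq_of_regular fun v => (hdR v).1, mul_div_cancel_left₀ _ hd']
    exact hna.le

end Walk

end

end EulerianMixing

theorem theorem1p2 :
    (∃ c₁ : ℝ, 0 < c₁ ∧
      ∀ (V : Type*) [Fintype V] [DecidableEq V] (G : Digraph V) (π : V → ℝ),
        EulerianMixing.IsConnected G → EulerianMixing.IsEulerian G →
        0 < EulerianMixing.edgeCount G →
        EulerianMixing.IsStationaryDistribution (EulerianMixing.lazyWalk G) π →
        (EulerianMixing.unifMixedTimes (EulerianMixing.lazyWalk G) π (1 / 4)).Nonempty ∧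
        (EulerianMixing.unifMixingTime (EulerianMixing.lazyWalk G) π (1 / 4) : ℝ) ≤
          c₁ * ((EulerianMixing.edgeCount G : ℝ) * (Fintype.card V : ℝ))) ∧
    (∃ c₂ : ℝ, 0 < c₂ ∧
      ∀ (V : Type*) [Fintype V] [DecidableEq V] (G : Digraph V) (π : V → ℝ),
        EulerianMixing.IsConnected G → EulerianMixing.IsEulerian G →
        0 < EulerianMixing.edgeCount G →
        EulerianMixing.IsStationaryDistribution (EulerianMixing.lazyWalk G) π →
        ∀ a : ℝ, 0 < a →
        (EulerianMixing.unifMixedTimes (EulerianMixing.lazyWalk G) π a).Nonempty ∧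
        (EulerianMixing.unifMixingTime (EulerianMixing.lazyWalk G) π a : ℝ) ≤
          c₂ / a * min ((EulerianMixing.edgeCount G : ℝ) * (Fintype.card V : ℝ))
            ((EulerianMixing.edgeCount G : ℝ) ^ 2 / a)) ∧
    (∃ c₃ : ℝ, 0 < c₃ ∧
      ∀ (V : Type*) [Fintype V] [DecidableEq V] (G : Digraph V) (π : V → ℝ),
        EulerianMixing.IsConnected G → EulerianMixing.IsEulerian G →
        0 < EulerianMixing.edgeCount G → EulerianMixing.IsRegular G →
        EulerianMixing.IsStationaryDistribution (EulerianMixing.lazyWalk G) π →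
        ∀ a : ℝ, 0 < a →
        (EulerianMixing.unifMixedTimes (EulerianMixing.lazyWalk G) π a).Nonempty ∧
        (EulerianMixing.unifMixingTime (EulerianMixing.lazyWalk G) π a : ℝ) ≤
          c₃ * ((Fintype.card V : ℝ) ^ 2 / a ^ 2)) := by
  -- 264 = 66 · 4 comes from a = 1/4; 130 serves both terms of the minimum, whose constants are 66
  -- and 130.
  refine ⟨⟨264, by norm_num, ?_⟩, ⟨130, by norm_num, ?_⟩, ⟨3074, by norm_num, ?_⟩⟩
  · intro V _ _ G π hC hE hm hπ
    have h := EulerianMixing.unifMixingTime_le_edges_mul_vertices hC hE hm hπ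
      (a := 1 / 4) (by norm_num)
    exact ⟨h.1, h.2.trans_eq (by ring)⟩
  · intro V _ _ G π hC hE hm hπ a ha
    have h1 := EulerianMixing.unifMixingTime_le_edges_mul_vertices hC hE hm hπ ha
    have h2 := EulerianMixing.unifMixingTime_le_edges_sq hC hE hm hπ ha
    refine ⟨h1.1, ?_⟩
    rw [mul_min_of_nonneg _ _ (by positivity)]
    refine le_min (h1.2.trans ?_) (h2.2.trans_eq (by field_simp))
    calc _ ≤ 130 * ((EulerianMixing.edgeCount G : ℝ) * Fintype.card V / a) :=
          mul_le_mul_of_nonneg_right (by norm_num) (by positivity)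
      _ = _ := by ring
  · intro V _ _ G π hC hE hm hR hπ a ha
    exact EulerianMixing.unifMixingTime_le_of_regular hC hE hm hR hπ ha
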